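/- All vector spaces and algebras are over $\mathbb{C}$, and products of basis elements that are not listed are zero. A Leibniz algebra is an algebra with $[x,[y,z]]=[[x,y],z]-[[x,z],y]$. A $k$-dimensional central extension of a Leibniz algebra $L$ is a Leibniz algebra $\widehat L$ in a short exact sequence of Leibniz algebras $0\to V\to\widehat L\to L\to 0$ in which $\dim V=k$ and the image of $V$ lies in the center of $\widehat L$; it is split if $\widehat L$ is the direct sum of two ideals one of which is nonzero and abelian, and non-split otherwise. Let $n\ge 4$ and let $F_n^2$ be the $n$-dimensional algebra with basis $e_1,\dots,e_n$ and products $[e_1,e_1]=e_3$, $[e_i,e_1]=e_{i+1}$ $(3\le i\le n-1)$. On a space with basis $e_1,\dots,e_{n+2}$ define the algebras - $N(\alpha_3,\alpha_4,\beta_3,\beta_4)$: $[e_i,e_1]=e_{i+1}$ $(1\le i\le n-1)$, $[e_{n+1},e_1]=e_{n+2}$, $[e_1,e_{n+1}]=\alpha_3e_n+\beta_3e_{n+2}$, $[e_{n+1},e_{n+1}]=\alpha_4e_n+\beta_4e_{n+2}$; - $R(\alpha_3,\alpha_4,\beta_3,\beta_4)$: $[e_i,e_1]=e_{i+1}$ $(1\le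 i\le n-2)$, $[e_n,e_1]=e_{n+1}$, $[e_1,e_n]=\alpha_3e_{n+1}+\beta_3e_{n+2}$, $[e_n,e_n]=\alpha_4e_{n+1}+\beta_4e_{n+2}$; - $L_{n+2}^{1,\lambda}$: $[e_i,e_1]=e_{i+1}$ $(1\le i\le n-1)$, $[e_{n+1},e_1]=e_{n+2}$, $[e_1,e_{n+1}]=\lambda e_{n+2}$; - $L_{n+2}^{2,\lambda}$: $[e_i,e_1]=e_{i+1}$ $(1\le i\le n-1)$, $[e_{n+1},e_1]=e_{n+2}$, $[e_1,e_{n+1}]=\lambda e_{n+2}$, $[e_{n+1},e_{n+1}]=e_{n+2}$; - $L_{n+2}^{2}$: $[e_i,e_1]=e_{i+1}$ $(1\le i\le n-1)$, $[e_1,e_{n+1}]=e_{n+2}$; - $N^*$: $[e_i,e_1]=e_{i+1}$ $(1\le i\le n-1)$, $[e_1,e_{n+1}]=e_{n+2}$, $[e_{n+1},e_{n+1}]=e_n$. **Theorem 4.5.** Every two-dimensional non-split central extension of $F_n^2$ is isomorphic, as an algebra, to one of the following algebras. Each algebra in the list is a two-dimensional non-split central extension of $F_n^2$, and the listed algebras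 are pairwise non-isomorphic (also for different values of the parameters within one family): - $N(1,0,0,0)$; $N(0,1,\beta_3,0)$ with $\beta_3\in\mathbb{C}\setminus\{0\}$; $N(1,0,0,1)$; $N(0,1,0,0)$; $N(0,1,1,1)$; - $R(0,0,1,0)$; $R(0,0,1,1)$; $R(0,1,1,\beta_4)$ with $\beta_4\in\mathbb{C}$; $R(1,0,0,1)$; - $L_{n+2}^{1,\lambda}$ with $\lambda\in\mathbb{C}$; $L_{n+2}^{2,\lambda}$ with $\lambda\in\{0,1\}$; $L_{n+2}^2$; $N^*$. -/

import Mathlib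

universe u v

noncomputable section

namespace Leib

/-- A (complex, not necessarily associative) algebra structure on a complex vector space `L` is a
bilinear product `L × L → L`. -/
abbrev Product (L : Type*) [AddCommGroup L] [Module ℂ L] : Type _ := L →ₗ[ℂ] L →ₗ[ℂ] L

section General

variable {V H L : Type*} [AddCommGroup V] [Module ℂ V] [AddCommGroup H] [Module ℂ H]
  [AddCommGroup L] [Module ℂ L]

/-- The (right) Leibniz identity `[x, [y, z]] = [[x, y], z] - [[x, z], y]`. -/
def IsLeibniz (br : Product L) : Prop :=
  ∀ x y z : L, br x (br y z) = br (br x y) z - br (br x z) y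

/-- Isomorphism of algebras: a linear bijection that preserves the products. -/
def Isomorphic (br : Product H) (br' : Product L) : Prop :=
  ∃ φ : H ≃ₗ[ℂ] L, ∀ x y : H, φ (br x y) = br' (φ x) (φ y)

/-- A two-sided ideal of an algebra. -/
def IsIdeal (br : Product L) (I : Submodule ℂ L) : Prop :=
  ∀ x ∈ I, ∀ y : L, br x y ∈ I ∧ br y x ∈ I

/-- An algebra is split if it is the direct sum of two ideals one of which is nonzero and abelian,
that is, if it is of the form `B ⊕ ℂ^j` with `j ≥ 1`. -/
def IsSplit (br : Product L) : Prop :=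
  ∃ I J : Submodule ℂ L, IsIdeal br I ∧ IsIdeal br J ∧ IsCompl I J ∧ J ≠ ⊥ ∧
    ∀ x ∈ J, ∀ y ∈ J, br x y = 0

/-- `0 ⟶ V ⟶ H ⟶ L ⟶ 0` (with maps `ε` and `π`) is a central extension of the Leibniz algebra
`(L, brL)` by `V`: a short exact sequence of Leibniz algebras in which the image of `V` lies in the
center of `(H, brH)`; `V` carries the zero product. -/
structure IsCentralExtension (brH : Product H) (brL : Product L)
    (ε : V →ₗ[ℂ] H) (π : H →ₗ[ℂ] L) : Prop where
  leibniz_total : IsLeibniz brH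
  leibniz_base : IsLeibniz brL
  map_bracket : ∀ x y : H, π (brH x y) = brL (π x) (π y)
  injective : Function.Injective ε
  exact : LinearMap.range ε = LinearMap.ker π
  surjective : Function.Surjective π
  central : ∀ (v : V) (x : H), brH (ε v) x = 0 ∧ brH x (ε v) = 0

end General

/-- The basis vector `e_i`, `1 ≤ i ≤ m`, of `ℂ^m` (numbering starts at `1`). -/
def e (m i : ℕ) : Fin m → ℂ := fun k => if (k : ℕ) + 1 = i then 1 else 0

/-- The algebra on `ℂ^m` with the multiplication table `[e_i, e_j] = t i j`, `1 ≤ i, j ≤ m`. -/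
def ofTable (m : ℕ) (t : ℕ → ℕ → (Fin m → ℂ)) : Product (Fin m → ℂ) :=
  LinearMap.mk₂ ℂ
    (fun x y => ∑ i : Fin m, ∑ j : Fin m, (x i * y j) • t ((i : ℕ) + 1) ((j : ℕ) + 1))
    (by intro x x' y; simp only [Pi.add_apply, add_mul, add_smul, Finset.sum_add_distrib])
    (by intro c x y; simp only [Pi.smul_apply, smul_eq_mul, mul_assoc, mul_smul, Finset.smul_sum])
    (by intro x y y'; simp only [Pi.add_apply, mul_add, add_smul, Finset.sum_add_distrib])
    (by
      intro c x y
      simp only [Pi.smul_apply, smul_eq_mul, mul_left_comm _ c, mul_smul, Finset.smul_sum])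

/-- `F_n^2 : [e_1, e_1] = e_3, [e_i, e_1] = e_{i+1} (3 ≤ i ≤ n-1)`. -/
def F2 (n : ℕ) : Product (Fin n → ℂ) :=
  ofTable n fun i j =>
    if i = 1 ∧ j = 1 then e n 3
    else if (3 ≤ i ∧ i + 1 ≤ n) ∧ j = 1 then e n (i + 1)
    else 0

/-- `N(α₃, α₄, β₃, β₄)`, of dimension `n + 2`:
`[e_i, e_1] = e_{i+1} (1 ≤ i ≤ n-1)`, `[e_{n+1}, e_1] = e_{n+2}`,
`[e_1, e_{n+1}] = α₃ e_n + β₃ e_{n+2}`, `[e_{n+1}, e_{n+1}] = α₄ e_n + β₄ e_{n+2}`. -/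
def N (n : ℕ) (α₃ α₄ β₃ β₄ : ℂ) : Product (Fin (n + 2) → ℂ) :=
  ofTable (n + 2) fun i j =>
    if (1 ≤ i ∧ i + 1 ≤ n) ∧ j = 1 then e (n + 2) (i + 1)
    else if i = n + 1 ∧ j = 1 then e (n + 2) (n + 2)
    else if i = 1 ∧ j = n + 1 then α₃ • e (n + 2) n + β₃ • e (n + 2) (n + 2)
    else if i = n + 1 ∧ j = n + 1 then α₄ • e (n + 2) n + β₄ • e (n + 2) (n + 2)
    else 0

/-- `R(α₃, α₄, β₃, β₄)`, of dimension `n + 2`: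
`[e_i, e_1] = e_{i+1} (1 ≤ i ≤ n-2)`, `[e_n, e_1] = e_{n+1}`,
`[e_1, e_n] = α₃ e_{n+1} + β₃ e_{n+2}`, `[e_n, e_n] = α₄ e_{n+1} + β₄ e_{n+2}`. -/
def R (n : ℕ) (α₃ α₄ β₃ β₄ : ℂ) : Product (Fin (n + 2) → ℂ) :=
  ofTable (n + 2) fun i j =>
    if (1 ≤ i ∧ i + 2 ≤ n) ∧ j = 1 then e (n + 2) (i + 1)
    else if i = n ∧ j = 1 then e (n + 2) (n + 1)
    else if i = 1 ∧ j = n then α₃ • e (n + 2) (n + 1) + β₃ • e (n + 2) (n + 2)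
    else if i = n ∧ j = n then α₄ • e (n + 2) (n + 1) + β₄ • e (n + 2) (n + 2)
    else 0

/-- `L_m^{1,lam} : [e_i, e_1] = e_{i+1} (1 ≤ i ≤ m-3)`, `[e_{m-1}, e_1] = e_m`,
`[e_1, e_{m-1}] = lam e_m`. -/
def L1 (m : ℕ) (lam : ℂ) : Product (Fin m → ℂ) :=
  ofTable m fun i j =>
    if (1 ≤ i ∧ i + 3 ≤ m) ∧ j = 1 then e m (i + 1)
    else if i + 1 = m ∧ j = 1 then e m m
    else if i = 1 ∧ j + 1 = m then lam • e m m
    else 0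

/-- `L_m^{2,lam} : [e_i, e_1] = e_{i+1} (1 ≤ i ≤ m-3)`, `[e_{m-1}, e_1] = e_m`,
`[e_1, e_{m-1}] = lam e_m`, `[e_{m-1}, e_{m-1}] = e_m`. -/
def L2 (m : ℕ) (lam : ℂ) : Product (Fin m → ℂ) :=
  ofTable m fun i j =>
    if (1 ≤ i ∧ i + 3 ≤ m) ∧ j = 1 then e m (i + 1)
    else if i + 1 = m ∧ j = 1 then e m m
    else if i = 1 ∧ j + 1 = m then lam • e m m
    else if i + 1 = m ∧ j + 1 = m then e m m
    else 0

/-- `L_m^2 : [e_i, e_1] = e_{i+1} (1 ≤ i ≤ m-3)`, `[e_1, e_{m-1}] = e_m`. -/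
def Lsq (m : ℕ) : Product (Fin m → ℂ) :=
  ofTable m fun i j =>
    if (1 ≤ i ∧ i + 3 ≤ m) ∧ j = 1 then e m (i + 1)
    else if i = 1 ∧ j + 1 = m then e m m
    else 0

/-- `N^*`, of dimension `n + 2`: `[e_i, e_1] = e_{i+1} (1 ≤ i ≤ n-1)`,
`[e_1, e_{n+1}] = e_{n+2}`, `[e_{n+1}, e_{n+1}] = e_n`. -/
def Nstar (n : ℕ) : Product (Fin (n + 2) → ℂ) :=
  ofTable (n + 2) fun i j =>
    if (1 ≤ i ∧ i + 1 ≤ n) ∧ j = 1 then e (n + 2) (i + 1)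
    else if i = 1 ∧ j = n + 1 then e (n + 2) (n + 2)
    else if i = n + 1 ∧ j = n + 1 then e (n + 2) n
    else 0

/-- The entries of the classification list, with their parameters. -/
inductive Entry : Type
  | N1000 : Entry
  | N01 (β₃ : ℂ) (h : β₃ ≠ 0) : Entry
  | N1001 : Entry
  | N0100 : Entry
  | N0111 : Entry
  | R0010 : Entry
  | R0011 : Entry
  | R011 (β₄ : ℂ) : Entry
  | R1001 : Entry
  | L1 (lam : ℂ) : Entry
  | L2 (lam : ℂ) (h : lam = 0 ∨ lam = 1) : Entry
  | Lsq : Entry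
  | Nstar : Entry

/-- The `(n + 2)`-dimensional algebra that an entry of the list denotes. -/
def Entry.algebra (n : ℕ) : Entry → Product (Fin (n + 2) → ℂ)
  | .N1000 => N n 1 0 0 0
  | .N01 β₃ _ => N n 0 1 β₃ 0
  | .N1001 => N n 1 0 0 1
  | .N0100 => N n 0 1 0 0
  | .N0111 => N n 0 1 1 1
  | .R0010 => R n 0 0 1 0
  | .R0011 => R n 0 0 1 1
  | .R011 β₄ => R n 0 1 1 β₄
  | .R1001 => R n 1 0 0 1
  | .L1 lam => Leib.L1 (n + 2) lam
  | .L2 lam _ => Leib.L2 (n + 2) lam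
  | .Lsq => Leib.Lsq (n + 2)
  | .Nstar => Leib.Nstar n

end Leib

end

noncomputable section

namespace Leib

/-! Put k = n - 2. The algebra F_n^2 is a chain X_0, ..., X_k with [X_i, X_0] = X_{i+1}, together
with one more vector Y that multiplies to zero with everything. In a central extension by ℂ², lift
X_0 and Y and replace the other X_i by left-normed powers of the lift of X_0. The Leibniz identity
then kills every product except those of the chain and four central vectors: A = [X_k, X_0], B = [Y,
X_0], C = [X_0, Y], D = [Y, Y] (`IsCentralExtension.exists_model`). The extension is non-split
exactly when A, B, C, D span ℂ² (`Quad.not_isSplit_model`, `Quad.spans_of_not_isSplit`).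

Since k ≥ 2, isomorphisms between spanning models reduce to X_0 ↦ aX_0 + bY, Y ↦ dY + fX_k with a, d
≠ 0, up to terms without effect on the constants. They send (A, B, C, D) to (a^{k+2} A, ad B + bd D
+ af A, ad C + bd D, d² D), read modulo GL_2 acting on ℂ² (`Quad.isomorphic_of_change`,
`Quad.relations_of_isomorphic`). The theorem is the list of orbits of this action. A ≠ 0 leads to
the families N, L and N^*; A = 0 leads to R. Orbits are separated by the linear relations among A,
B, C, D, a formulation that does not involve GL_2. -/

theorem Isomorphic.symm {H L : Type*} [AddCommGroup H] [Module ℂ H] [AddCommGroup L] [Module ℂ L]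
    {br : Product H} {br' : Product L} (h : Isomorphic br br') : Isomorphic br' br := by
  obtain ⟨φ, hφ⟩ := h
  exact ⟨φ.symm, fun x y => φ.injective (by simp [hφ])⟩

theorem Isomorphic.trans {H L M : Type*} [AddCommGroup H] [Module ℂ H] [AddCommGroup L]
    [Module ℂ L] [AddCommGroup M] [Module ℂ M] {br : Product H} {br' : Product L}
    {br'' : Product M} (h : Isomorphic br br') (h' : Isomorphic br' br'') :
    Isomorphic br br'' := by
  obtain ⟨φ, hφ⟩ := h
  obtain ⟨ψ, hψ⟩ := h'
  exact ⟨φ.trans ψ, fun x y => by simp [hφ, hψ]⟩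

theorem IsSplit.of_isomorphic {H L : Type*} [AddCommGroup H] [Module ℂ H] [AddCommGroup L]
    [Module ℂ L] {br : Product H} {br' : Product L} (h : Isomorphic br br') (hs : IsSplit br) :
    IsSplit br' := by
  obtain ⟨φ, hφ⟩ := h
  obtain ⟨I, J, hI, hJ, hIJ, hne, hab⟩ := hs
  have ideal : ∀ K : Submodule ℂ H, IsIdeal br K → IsIdeal br' (K.map φ.toLinearMap) := by
    rintro K hK _ ⟨x, hx, rfl⟩ y
    obtain ⟨y, rfl⟩ := φ.surjective y
    exact ⟨⟨br x y, (hK x hx y).1, hφ x y⟩, ⟨br y x, (hK x hx y).2, hφ y x⟩⟩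
  refine ⟨_, _, ideal I hI, ideal J hJ, ?_, ?_, ?_⟩
  · exact hIJ.map (Submodule.orderIsoMapComap φ)
  · exact fun h0 => hne (Submodule.map_eq_bot_iff.1 h0)
  · rintro _ ⟨x, hx, rfl⟩ _ ⟨y, hy, rfl⟩
    have := hφ x y
    rw [hab x hx y hy, map_zero] at this
    exact this.symm

/-! ### Coordinate models of F_n^2 and of its extensions -/

/-- The right multiplication by the generator of the null-filiform algebra:
`X_i ↦ X_{i+1}`, and the last basis vector goes to `0`. -/
def shift (k : ℕ) : (Fin (k + 1) → ℂ) →ₗ[ℂ] (Fin (k + 1) → ℂ) where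
  toFun u := Fin.cons 0 (fun i => u i.castSucc)
  map_add' u v := by ext i; refine Fin.cases ?_ (fun i => ?_) i <;> simp
  map_smul' c u := by ext i; refine Fin.cases ?_ (fun i => ?_) i <;> simp

@[simp] theorem shift_zero {k : ℕ} (u : Fin (k + 1) → ℂ) : shift k u 0 = 0 := rfl

@[simp] theorem shift_succ {k : ℕ} (u : Fin (k + 1) → ℂ) (i : Fin k) :
    shift k u i.succ = u i.castSucc := rfl

/-- `F_{k+2}^2` in coordinates: a chain `X_0, …, X_k` and one more central vector. -/
def base (k : ℕ) : Product ((Fin (k + 1) → ℂ) × ℂ) :=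
  LinearMap.mk₂ ℂ (fun x y => (y.1 0 • shift k x.1, 0))
    (by intro x x' y; simp)
    (by intro c x y; ext <;> simp; ring)
    (by intro x y y'; simp [add_smul])
    (by intro c x y; simp [mul_smul])

@[simp] theorem base_apply {k : ℕ} (x y : (Fin (k + 1) → ℂ) × ℂ) :
    base k x y = (y.1 0 • shift k x.1, 0) := rfl

/-- The values of a two-dimensional cocycle on `F_n^2` that matter up to coboundaries. -/
structure Quad where
  A : ℂ × ℂ
  B : ℂ × ℂ
  C : ℂ × ℂ
  D : ℂ × ℂ

/-- The underlying space of a two-dimensional central extension of `base k`. -/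
abbrev Carrier (k : ℕ) : Type := (Fin (k + 1) → ℂ) × ℂ × (ℂ × ℂ)

/-- The central extension of `base k` by `ℂ²`, with basis `X_0, …, X_k, Y` over `ℂ²` and products
`[X_i, X_0] = X_{i+1}`, `[X_k, X_0] = A`, `[Y, X_0] = B`, `[X_0, Y] = C`, `[Y, Y] = D`. -/
def Quad.model (k : ℕ) (q : Quad) : Product (Carrier k) :=
  LinearMap.mk₂ ℂ (fun x y => (y.1 0 • shift k x.1, 0,
      y.1 0 • (x.1 (Fin.last k) • q.A + x.2.1 • q.B) + y.2.1 • (x.1 0 • q.C + x.2.1 • q.D)))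
    (by intro x x' y; ext <;> simp <;> ring)
    (by intro c x y; ext <;> simp <;> ring)
    (by intro x y y'; ext <;> simp <;> ring)
    (by intro c x y; ext <;> simp <;> ring)

theorem Quad.model_apply {k : ℕ} (q : Quad) (x y : Carrier k) :
    q.model k x y = (y.1 0 • shift k x.1, 0,
      y.1 0 • (x.1 (Fin.last k) • q.A + x.2.1 • q.B) +
        y.2.1 • (x.1 0 • q.C + x.2.1 • q.D)) := rfl

theorem ofTable_e (m : ℕ) (t : ℕ → ℕ → (Fin m → ℂ)) (i j : Fin m) :
    ofTable m t (Pi.single i 1) (Pi.single j 1) = t (i + 1) (j + 1) := by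
  rw [ofTable, LinearMap.mk₂_apply, Finset.sum_eq_single i, Finset.sum_eq_single j]
  · simp
  · intro b _ hb; simp [hb]
  · simp
  · intro b _ hb; simp [hb]
  · simp

theorem single_eq_e {m : ℕ} (i : Fin m) : (Pi.single i 1 : Fin m → ℂ) = e m (i + 1) := by
  ext j
  simp [e, Pi.single_apply, Fin.ext_iff]

/-- To check that a linear bijection carries a multiplication table to a product it suffices to
look at basis vectors. -/
theorem isomorphic_ofTable {m : ℕ} {t : ℕ → ℕ → (Fin m → ℂ)} {K : Type*} [AddCommGroup K]
    [Module ℂ K] [FiniteDimensional ℂ K] {br : Product K} (E : (Fin m → ℂ) →ₗ[ℂ] K)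
    (hE : Function.Injective E) (hd : m = Module.finrank ℂ K)
    (h : ∀ i j, i < m → j < m → E (t (i + 1) (j + 1)) = br (E (e m (i + 1))) (E (e m (j + 1)))) :
    Isomorphic (ofTable m t) br := by
  refine ⟨LinearMap.linearEquivOfInjective E hE (by simpa using hd), fun x y => ?_⟩
  have key : (ofTable m t).compr₂ E = br.compl₁₂ E E := by
    refine LinearMap.ext_basis (Pi.basisFun ℂ _) (Pi.basisFun ℂ _) fun i j => ?_
    simp only [Pi.basisFun_apply, LinearMap.compr₂_apply, LinearMap.compl₁₂_apply, ofTable_e]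
    rw [single_eq_e, single_eq_e]
    exact h i j i.2 j.2
  simpa using LinearMap.congr_fun₂ key x y

/-- Coordinates on `F_{k+2}^2`. -/
def coordF (k : ℕ) : (Fin (k + 2) → ℂ) →ₗ[ℂ] (Fin (k + 1) → ℂ) × ℂ :=
  (LinearMap.funLeft ℂ ℂ (Fin.succAbove 1)).prod (LinearMap.proj 1)

/-- The index jumps because Y = e_2 is taken out of the sequence: X_0 = e_1, and X_i = e_{i+2} for i
≥ 1. -/
theorem coordF_e {k j : ℕ} : coordF k (e (k + 2) j) =
    (fun i : Fin (k + 1) =>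
      if ((i : ℕ) = 0 ∧ j = 1) ∨ ((i : ℕ) ≠ 0 ∧ j = (i : ℕ) + 2) then 1 else 0,
      if j = 2 then 1 else 0) := by
  refine Prod.ext (funext fun i => ?_) ?_
  · refine Fin.cases ?_ (fun i => ?_) i
    · simp [coordF, LinearMap.funLeft_apply, e, eq_comm]
    · have : Fin.succAbove (1 : Fin (k + 2)) i.succ = i.succ.succ := by
        rw [Fin.succAbove_of_le_castSucc]
        simp [Fin.le_def]
      simp [coordF, LinearMap.funLeft_apply, this, e, eq_comm]
  · simp [coordF, e, eq_comm]

theorem F2_isomorphic_base (k : ℕ) : Isomorphic (F2 (k + 2)) (base k) := by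
  refine isomorphic_ofTable (coordF k) ?_ (by simp) ?_
  · rw [injective_iff_map_eq_zero]
    intro x hx
    ext i
    have h1 := congrArg Prod.fst hx
    have h2 := congrArg Prod.snd hx
    rcases Fin.eq_self_or_eq_succAbove 1 i with rfl | ⟨j, rfl⟩
    · exact h2
    · exact congrFun h1 j
  · intro i j hi hj
    by_cases hj0 : j = 0
    · refine Prod.ext (funext fun l => ?_) ?_
      · refine Fin.cases ?_ (fun l => ?_) l
        · subst hj0
          split_ifs <;> simp [coordF_e]
        · subst hj0
          have := l.2
          split_ifs <;> simp [coordF_e, -Fin.val_eq_zero_iff] <;> grind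
      · split_ifs <;> simp [coordF_e] <;> omega
    · simp [coordF_e, hj0]
      rfl

/-! ### Linear algebra in ℂ² -/

/-- The determinant of two vectors of `ℂ²`. -/
def det (P Q : ℂ × ℂ) : ℂ := P.1 * Q.2 - P.2 * Q.1

theorem eq_zero_of_det_ne_zero {P Q : ℂ × ℂ} (h : det P Q ≠ 0) {s t : ℂ}
    (hst : s • P + t • Q = 0) : s = 0 ∧ t = 0 := by
  have h1 : s * P.1 + t * Q.1 = 0 := congrArg Prod.fst hst
  have h2 : s * P.2 + t * Q.2 = 0 := congrArg Prod.snd hst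
  constructor
  · refine (mul_eq_zero.1 (?_ : s * det P Q = 0)).resolve_right h
    unfold det; linear_combination Q.2 * h1 - Q.1 * h2
  · refine (mul_eq_zero.1 (?_ : t * det P Q = 0)).resolve_right h
    unfold det; linear_combination P.1 * h2 - P.2 * h1

theorem exists_eq_of_det_ne_zero {P Q : ℂ × ℂ} (h : det P Q ≠ 0) (v : ℂ × ℂ) :
    ∃ s t : ℂ, v = s • P + t • Q := by
  refine ⟨det v Q / det P Q, det P v / det P Q, ?_⟩
  ext <;> simp <;> field_simp <;> unfold det <;> ring

theorem exists_smul_of_det_eq_zero {P Q : ℂ × ℂ} (h : det P Q = 0) (hP : P ≠ 0) :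
    ∃ s : ℂ, Q = s • P := by
  unfold det at h
  by_cases h1 : P.1 = 0
  · have h2 : P.2 ≠ 0 := fun h2 => hP (Prod.ext h1 h2)
    refine ⟨Q.2 / P.2, ?_⟩
    have : Q.1 = 0 := by simpa [h1, h2] using h
    ext <;> simp [h1, this, h2]
  · refine ⟨Q.1 / P.1, ?_⟩
    ext
    · simp [h1]
    · simp
      field_simp
      linear_combination h

theorem shift_one {k : ℕ} (u : Fin (k + 2 + 1) → ℂ) : shift (k + 2) u 1 = u 0 := rfl

/-! ### Isomorphisms between models -/

/-- The effect of a change of the generators `X_0 ↦ a X_0 + b Y`, `Y ↦ d Y + f X_k` on the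
structure constants of the model. The new basis of `ℂ²` is `P, Q`. -/
theorem Quad.isomorphic_of_change {k : ℕ} (hk : 2 ≤ k) {q q' : Quad} {a b d f : ℂ} (ha : a ≠ 0)
    (hd : d ≠ 0) {P Q : ℂ × ℂ} (hPQ : det P Q ≠ 0)
    (hA : q'.A.1 • P + q'.A.2 • Q = a ^ (k + 2) • q.A)
    (hB : q'.B.1 • P + q'.B.2 • Q = (a * d) • q.B + (b * d) • q.D + (a * f) • q.A)
    (hC : q'.C.1 • P + q'.C.2 • Q = (a * d) • q.C + (b * d) • q.D)
    (hD : q'.D.1 • P + q'.D.2 • Q = d ^ 2 • q.D) :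
    Isomorphic (q.model k) (q'.model k) := by
  obtain ⟨k, rfl⟩ := Nat.exists_eq_add_of_le' hk
  -- The square of aX_0 + bY is a² X_1 plus a central vector, which is the correction attached to
  -- the coordinate `p.1 1`. The next power is a³ X_2 with no correction, and X_1 is not the end of
  -- the chain, so A is only rescaled.
  let ψ : Carrier (k + 2) →ₗ[ℂ] Carrier (k + 2) :=
    { toFun p := (fun i => a ^ ((i : ℕ) + 1) * p.1 i + if i = Fin.last _ then f * p.2.1 else 0,
        b * p.1 0 + d * p.2.1,
        p.2.2.1 • P + p.2.2.2 • Q + p.1 1 • ((a * b) • (q.B + q.C) + b ^ 2 • q.D))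
      map_add' x y := by
        refine Prod.ext (funext fun i => ?_) ?_
        · dsimp; split_ifs <;> ring
        · ext <;> simp <;> ring
      map_smul' c x := by
        refine Prod.ext (funext fun i => ?_) ?_
        · dsimp; split_ifs <;> ring
        · ext <;> simp <;> ring }
  have hψ (p : Carrier (k + 2)) : ψ p =
      (fun i : Fin (k + 2 + 1) => a ^ ((i : ℕ) + 1) * p.1 i + if i = Fin.last _ then f * p.2.1 else 0,
        b * p.1 0 + d * p.2.1,
        p.2.2.1 • P + p.2.2.2 • Q + p.1 1 • ((a * b) • (q.B + q.C) + b ^ 2 • q.D)) := rfl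
  have inj : Function.Injective ψ := by
    rw [injective_iff_map_eq_zero]
    rintro ⟨u, s, v⟩ h
    rw [hψ] at h
    have h1 := congrFun (congrArg Prod.fst h)
    have h2 : b * u 0 + d * s = 0 := congrArg (fun p : Carrier (k + 2) => p.2.1) h
    have h3 := congrArg (fun p : Carrier (k + 2) => p.2.2) h
    dsimp at h1 h3
    have hu (i : Fin (k + 3)) (hi : i ≠ Fin.last _) : u i = 0 := by
      simpa [hi, ha] using h1 i
    have hu0 : u 0 = 0 := hu 0 (by simp [Fin.ext_iff])
    have hu1 : u 1 = 0 := hu 1 (by simp [Fin.ext_iff])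
    have hs : s = 0 := by simpa [hu0, hd] using h2
    have hul : u (Fin.last _) = 0 := by simpa [ha, hs] using h1 (Fin.last _)
    rw [hu1, zero_smul, add_zero] at h3
    have hv := eq_zero_of_det_ne_zero hPQ h3
    refine Prod.ext (funext fun i => ?_) (Prod.ext hs (Prod.ext hv.1 hv.2))
    by_cases hi : i = Fin.last _
    · rw [hi]; exact hul
    · exact hu i hi
  refine Isomorphic.symm ⟨LinearEquiv.ofInjectiveEndo ψ inj, ?_⟩
  rintro ⟨u, s, v⟩ ⟨u', s', v'⟩
  simp only [LinearEquiv.coe_ofInjectiveEndo, hψ, Quad.model_apply]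
  have hA1 := congrArg Prod.fst hA
  have hA2 := congrArg Prod.snd hA
  have hB1 := congrArg Prod.fst hB
  have hB2 := congrArg Prod.snd hB
  have hC1 := congrArg Prod.fst hC
  have hC2 := congrArg Prod.snd hC
  have hD1 := congrArg Prod.fst hD
  have hD2 := congrArg Prod.snd hD
  simp only [Prod.fst_add, Prod.snd_add, Prod.smul_fst, Prod.smul_snd, smul_eq_mul] at *
  refine Prod.ext (funext fun i => ?_) (Prod.ext ?_ (Prod.ext ?_ ?_))
  · refine Fin.cases ?_ (fun i => ?_) i
    · simp
    · have : i.castSucc ≠ Fin.last _ := Fin.castSucc_ne_last i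
      have h0 : (0 : Fin (k + 3)) ≠ Fin.last _ := by simp [Fin.ext_iff]
      simp [this, h0]
      ring
  · simp
  · have h0 : (0 : Fin (k + 3)) ≠ Fin.last _ := by simp [Fin.ext_iff]
    simp [h0, shift_one]
    linear_combination u' 0 * u (Fin.last _) * hA1 + u' 0 * s * hB1 + s' * u 0 * hC1 + s' * s * hD1
  · have h0 : (0 : Fin (k + 3)) ≠ Fin.last _ := by simp [Fin.ext_iff]
    simp [h0, shift_one]
    linear_combination u' 0 * u (Fin.last _) * hA2 + u' 0 * s * hB2 + s' * u 0 * hC2 + s' * s * hD2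

/-- The chain vector `X_i` of the model. -/
def chain (k : ℕ) (i : Fin (k + 1)) : Carrier k := (Pi.single i 1, 0, 0)

/-- The generator `Y` of the model. -/
def gen (k : ℕ) : Carrier k := (0, 1, 0)

theorem chain_succ {k : ℕ} (q : Quad) (i : Fin k) :
    q.model k (chain k i.castSucc) (chain k 0) = chain k i.succ := by
  refine Prod.ext (funext fun l => ?_) ?_
  · refine Fin.cases ?_ (fun l => ?_) l
    · simp [chain, Quad.model_apply, Fin.ext_iff]
    · simp [chain, Quad.model_apply, Pi.single_apply, Fin.ext_iff]
  · simp [chain, Quad.model_apply, Pi.single_apply, Fin.ext_iff]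
    rintro h
    omega

theorem shift_last (k : ℕ) : shift k (Pi.single (Fin.last k) 1) = 0 := by
  ext l
  refine Fin.cases ?_ (fun l => ?_) l
  · simp
  · simp [Pi.single_apply, Fin.ext_iff]
    omega

theorem chain_last {k : ℕ} (q : Quad) :
    q.model k (chain k (Fin.last k)) (chain k 0) = (0, 0, q.A) := by
  simp [chain, Quad.model_apply, shift_last]

theorem gen_chain {k : ℕ} (q : Quad) :
    q.model k (gen k) (chain k 0) = (0, 0, q.B) := by
  simp [chain, gen, Quad.model_apply]

theorem chain_gen {k : ℕ} (q : Quad) :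
    q.model k (chain k 0) (gen k) = (0, 0, q.C) := by
  simp [chain, gen, Quad.model_apply]

theorem gen_gen {k : ℕ} (q : Quad) :
    q.model k (gen k) (gen k) = (0, 0, q.D) := by
  simp [gen, Quad.model_apply]

theorem eq_sum_chain {k : ℕ} (p : Carrier k) :
    p = ∑ i, p.1 i • chain k i + p.2.1 • gen k + (0, 0, p.2.2) := by
  refine Prod.ext ?_ (Prod.ext ?_ ?_)
  · ext i
    simp [chain, gen, Prod.fst_sum, Finset.sum_apply, Pi.single_apply]
  · simp [chain, gen, Prod.snd_sum]
  · simp [chain, gen, Prod.snd_sum]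

/-- The vectors without components along the generators `X_0` and `Y`. -/
def derived (k : ℕ) : Submodule ℂ (Carrier k) where
  carrier := {p | p.1 0 = 0 ∧ p.2.1 = 0}
  add_mem' := by
    rintro v w ⟨h1, h2⟩ ⟨h3, h4⟩
    simp [h1, h2, h3, h4]
  zero_mem' := by simp
  smul_mem' := by
    rintro c v ⟨h1, h2⟩
    simp [h1, h2]

theorem mem_derived {k : ℕ} {p : Carrier k} : p ∈ derived k ↔ p.1 0 = 0 ∧ p.2.1 = 0 := Iff.rfl

/-- Two of the structure constants form a basis of `ℂ²`. -/
def Quad.Spans (q : Quad) : Prop :=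
  det q.A q.B ≠ 0 ∨ det q.A q.C ≠ 0 ∨ det q.A q.D ≠ 0 ∨ det q.B q.C ≠ 0 ∨ det q.B q.D ≠ 0 ∨
    det q.C q.D ≠ 0

theorem Quad.Spans.mem {q : Quad} (hq : q.Spans) {S : Submodule ℂ (ℂ × ℂ)} (hA : q.A ∈ S)
    (hB : q.B ∈ S) (hC : q.C ∈ S) (hD : q.D ∈ S) (v : ℂ × ℂ) : v ∈ S := by
  have key {P Q : ℂ × ℂ} (h : det P Q ≠ 0) (hP : P ∈ S) (hQ : Q ∈ S) : v ∈ S := by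
    obtain ⟨s, t, rfl⟩ := exists_eq_of_det_ne_zero h v
    exact S.add_mem (S.smul_mem _ hP) (S.smul_mem _ hQ)
  rcases hq with h | h | h | h | h | h
  · exact key h hA hB
  · exact key h hA hC
  · exact key h hA hD
  · exact key h hB hC
  · exact key h hB hD
  · exact key h hC hD

/-- An isomorphism between models is, up to terms that do not matter, a change of generators
`X_0 ↦ a X_0 + b Y`, `Y ↦ d Y + f X_k`, and it carries linear relations between the structure
constants to linear relations. -/
theorem Quad.relations_of_isomorphic {k : ℕ} (hk : 2 ≤ k) {q q' : Quad} (hq : q.Spans)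
    (h : Isomorphic (q.model k) (q'.model k)) :
    ∃ a b d f : ℂ, a ≠ 0 ∧ d ≠ 0 ∧ ∀ α β γ δ : ℂ,
      α • q.A + β • q.B + γ • q.C + δ • q.D = 0 →
      α • (a ^ (k + 2) • q'.A) +
        β • ((a * d) • q'.B + (b * d) • q'.D + (a * f) • q'.A) +
        γ • ((a * d) • q'.C + (b * d) • q'.D) + δ • (d ^ 2 • q'.D) = 0 := by
  obtain ⟨k, rfl⟩ := Nat.exists_eq_add_of_le' hk
  obtain ⟨φ, hφ⟩ := h
  set x := φ (chain _ 0) with hx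
  set y := φ (gen _) with hy
  have e1 (i : Fin (k + 2)) : φ (chain _ i.succ) = q'.model _ (φ (chain _ i.castSucc)) x := by
    rw [hx, ← hφ, chain_succ]
  have hs (i : Fin (k + 2)) : (φ (chain _ i.succ)).2.1 = 0 := by rw [e1, Quad.model_apply]
  have hz (i : Fin (k + 2)) : (φ (chain _ i.succ)).1 0 = 0 := by
    rw [e1, Quad.model_apply]; simp
  have hd (i : Fin (k + 3)) : (φ (chain _ i)).1 i = x.1 0 ^ ((i : ℕ) + 1) := by
    induction i using Fin.induction with
    | zero => simp [hx]
    | succ i ih =>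
      rw [e1, Quad.model_apply]
      simp [ih]
      ring
  have hA : φ (0, 0, q.A) = q'.model _ (φ (chain _ (Fin.last _))) x := by
    rw [hx, ← hφ, chain_last]
  have hB : φ (0, 0, q.B) = q'.model _ y x := by rw [hx, hy, ← hφ, gen_chain]
  have hC : φ (0, 0, q.C) = q'.model _ x y := by rw [hx, hy, ← hφ, chain_gen]
  have hD : φ (0, 0, q.D) = q'.model _ y y := by rw [hy, ← hφ, gen_gen]
  -- The image of X_1 is a product, so it has no X_0 or Y component. If x had no X_0 component
  -- either, the image of X_2 = [X_1, X_0] would vanish.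
  have ha : x.1 0 ≠ 0 := by
    intro ha
    have h2 := e1 1
    have : φ (chain (k + 2) (Fin.succ 1)) = 0 := by
      rw [h2, Quad.model_apply, ha]
      have hs0 : (φ (chain (k + 2) (Fin.castSucc 1))).2.1 = 0 := hs 0
      have hz0 : (φ (chain (k + 2) (Fin.castSucc 1))).1 0 = 0 := hz 0
      simp only [hs0, hz0]
      simp
    rw [map_eq_zero_iff φ φ.injective] at this
    have h3 := congrFun (congrArg Prod.fst this) (Fin.succ 1)
    simp [chain] at h3
  -- [[Y, X_0], X_0] = 0, while [[y, x], x] has X_2-coefficient equal to that of X_0 in y times a².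
  have hc : y.1 0 = 0 := by
    have h1 : φ (q.model _ (0, 0, q.B) (chain _ 0)) = q'.model _ (q'.model _ y x) x := by
      rw [hφ, hB]
    have h0 : q.model (k + 2) (0, 0, q.B) (chain _ 0) = 0 := by
      simp [Quad.model_apply]
    rw [h0, map_zero] at h1
    have h2 := congrFun (congrArg Prod.fst h1) 2
    have h3 (u : Fin (k + 3) → ℂ) : shift (k + 2) (shift (k + 2) u) 2 = u 0 := rfl
    simpa [Quad.model_apply, h3, ha] using h2
  refine ⟨x.1 0, x.2.1, y.2.1, y.1 (Fin.last _), ha, ?_, ?_⟩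
  -- If y had no Y component it would lie in `derived`, as do the images of X_1, ..., X_k and, by
  -- the spanning hypothesis, of ℂ². Modulo `derived` the image would be the line of x,
  -- contradicting surjectivity.
  · intro hd0
    obtain ⟨p, hp⟩ := φ.surjective (gen _)
    have hv (v : ℂ × ℂ) : (φ (0, 0, v)).1 0 = 0 ∧ (φ (0, 0, v)).2.1 = 0 := by
      let S : Submodule ℂ (ℂ × ℂ) := (derived (k + 2)).comap
        (φ.toLinearMap ∘ₗ LinearMap.inr ℂ _ _ ∘ₗ LinearMap.inr ℂ _ _)
      have prod (u : ℂ × ℂ) (z w : Carrier (k + 2)) (h : φ (0, 0, u) = q'.model _ z w) :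
          u ∈ S := by
        change φ (0, 0, u) ∈ derived (k + 2)
        rw [h, mem_derived]
        simp [Quad.model_apply]
      exact hq.mem (prod _ _ _ hA) (prod _ _ _ hB) (prod _ _ _ hC) (prod _ _ _ hD) v
    have hp' := hp
    rw [eq_sum_chain p] at hp'
    simp only [map_add, map_smul, map_sum, Fin.sum_univ_succ (n := k + 2), ← hx, ← hy] at hp'
    have h1 := congrFun (congrArg Prod.fst hp') 0
    have h2 := congrArg (fun p : Carrier (k + 2) => p.2.1) hp'
    simp [Prod.fst_sum, Prod.snd_sum, hz, hs, hv, hc, ha, hd0, gen] at h1 h2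
    simp [h1] at h2
  · intro α β γ δ hrel
    have : φ (α • (0, 0, q.A) + β • (0, 0, q.B) + γ • (0, 0, q.C) + δ • (0, 0, q.D)) = 0 := by
      rw [map_eq_zero_iff φ φ.injective]
      simpa using hrel
    simp only [map_add, map_smul, hA, hB, hC, hD] at this
    have h3 := congrArg (fun p : Carrier (k + 2) => p.2.2) this
    have hsl : (φ (chain _ (Fin.last (k + 2)))).2.1 = 0 := hs (Fin.last _)
    have hzl : (φ (chain _ (Fin.last (k + 2)))).1 0 = 0 := hz (Fin.last _)
    simp only [Quad.model_apply, hd, hsl, hzl, hc, Prod.snd_add, Prod.smul_snd, Prod.snd_zero] at h3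
    rw [← h3]
    ext <;> simp <;> ring

/-! ### Models as central extensions, and when they split -/

theorem Quad.isLeibniz_model (k : ℕ) (q : Quad) : IsLeibniz (q.model k) := by
  rintro ⟨u, s, v⟩ ⟨u', s', v'⟩ ⟨u'', s'', v''⟩
  refine Prod.ext ?_ (Prod.ext ?_ ?_)
  · simp [Quad.model_apply, smul_comm (u'' 0) (u' 0)]
  · simp [Quad.model_apply]
  · simp only [Quad.model_apply]
    ext <;> simp <;> ring

theorem IsCentralExtension.of_isomorphic {V H H' L L' : Type*} [AddCommGroup V] [Module ℂ V]
    [AddCommGroup H] [Module ℂ H] [AddCommGroup H'] [Module ℂ H'] [AddCommGroup L] [Module ℂ L]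
    [AddCommGroup L'] [Module ℂ L'] {brH : Product H} {brH' : Product H'} {brL : Product L}
    {brL' : Product L'} {ε : V →ₗ[ℂ] H} {π : H →ₗ[ℂ] L}
    (h : IsCentralExtension brH brL ε π) (φ : H ≃ₗ[ℂ] H')
    (hφ : ∀ x y, φ (brH x y) = brH' (φ x) (φ y)) (ψ : L ≃ₗ[ℂ] L')
    (hψ : ∀ x y, ψ (brL x y) = brL' (ψ x) (ψ y)) :
    IsCentralExtension brH' brL' (φ.toLinearMap ∘ₗ ε)
      (ψ.toLinearMap ∘ₗ π ∘ₗ φ.symm.toLinearMap) := by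
  have hφ' (x y) : φ.symm (brH' x y) = brH (φ.symm x) (φ.symm y) :=
    φ.injective (by simp [hφ])
  constructor
  · intro x y z
    apply φ.symm.injective
    simp only [hφ', map_sub]
    exact h.leibniz_total _ _ _
  · intro x y z
    obtain ⟨x, rfl⟩ := ψ.surjective x
    obtain ⟨y, rfl⟩ := ψ.surjective y
    obtain ⟨z, rfl⟩ := ψ.surjective z
    simp only [← hψ, ← map_sub]
    rw [h.leibniz_base]
  · intro x y
    simp [hφ', h.map_bracket, hψ]
  · exact φ.injective.comp h.injective
  · ext x
    have := SetLike.ext_iff.1 h.exact (φ.symm x)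
    simp only [LinearMap.mem_range, LinearMap.mem_ker] at this
    simp [← this, LinearEquiv.eq_symm_apply]
  · exact ψ.surjective.comp (h.surjective.comp φ.symm.surjective)
  · intro v x
    obtain ⟨x, rfl⟩ := φ.surjective x
    simp [← hφ, h.central v x]

theorem Quad.isCentralExtension_model (k : ℕ) (q : Quad) :
    IsCentralExtension (q.model k) (base k)
      (LinearMap.inr ℂ _ _ ∘ₗ LinearMap.inr ℂ _ _ : ℂ × ℂ →ₗ[ℂ] Carrier k)
      ((LinearMap.fst ℂ _ _).prod (LinearMap.fst ℂ _ _ ∘ₗ LinearMap.snd ℂ _ _)) where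
  leibniz_total := q.isLeibniz_model k
  leibniz_base := by
    rintro ⟨u, s⟩ ⟨u', s'⟩ ⟨u'', s''⟩
    simp [smul_comm (u'' 0) (u' 0)]
  map_bracket x y := by simp [Quad.model_apply]
  injective v w h := by simpa using h
  exact := by
    ext ⟨u, s, v⟩
    simp [eq_comm]
  surjective := by
    rintro ⟨u, s⟩
    exact ⟨(u, s, 0), rfl⟩
  central v x := by simp [Quad.model_apply]

/-- An abelian direct summand J is central, and all products lie in the complement I. A central
vector has no X_0 component, and none along Y because of the spanning hypothesis. It is therefore a
sum of products, so J ⊆ I and J = 0. -/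
theorem Quad.not_isSplit_model {k : ℕ} (hk : 1 ≤ k) {q : Quad} (hq : q.Spans) :
    ¬ IsSplit (q.model k) := by
  obtain ⟨k, rfl⟩ := Nat.exists_eq_add_of_le' hk
  rintro ⟨I, J, hI, hJ, hIJ, hne, hab⟩
  have split (x) : ∃ i ∈ I, ∃ j ∈ J, i + j = x := by
    have : x ∈ I ⊔ J := by rw [hIJ.sup_eq_top]; trivial
    exact Submodule.mem_sup.1 this
  have disj (x) (h1 : x ∈ I) (h2 : x ∈ J) : x = 0 :=
    (Submodule.disjoint_def.1 hIJ.disjoint) x h1 h2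
  have central (j) (hj : j ∈ J) (x) : q.model (k + 1) j x = 0 ∧ q.model (k + 1) x j = 0 := by
    obtain ⟨i, hi, j', hj', rfl⟩ := split x
    have h1 := disj _ (hI i hi j).1 (hJ j hj i).2
    have h2 := disj _ (hI i hi j).2 (hJ j hj i).1
    simp [h1, h2, hab j hj j' hj', hab j' hj' j hj]
  have prod (x y) : q.model (k + 1) x y ∈ I := by
    obtain ⟨i, hi, j, hj, rfl⟩ := split x
    rw [map_add, LinearMap.add_apply, (central j hj y).1, add_zero]
    exact (hI i hi y).1
  obtain ⟨j, hj, hj0⟩ := (Submodule.ne_bot_iff J).1 hne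
  refine hj0 (disj j ?_ hj)
  have hV (v : ℂ × ℂ) : ((0, 0, v) : Carrier (k + 1)) ∈ I := by
    let S : Submodule ℂ (ℂ × ℂ) := I.comap (LinearMap.inr ℂ _ _ ∘ₗ LinearMap.inr ℂ _ _)
    have key (u : ℂ × ℂ) (z w) (h : q.model (k + 1) z w = (0, 0, u)) : u ∈ S := by
      change (0, 0, u) ∈ I
      rw [← h]
      exact prod z w
    exact hq.mem (S := S) (key _ _ _ (chain_last q)) (key _ _ _ (gen_chain q))
      (key _ _ _ (chain_gen q)) (key _ _ _ (gen_gen q)) v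
  have hX := (central j hj (chain _ 0)).1
  have hY := (central j hj (chain _ 0)).2
  have hYY := (central j hj (gen _)).2
  rw [Quad.model_apply] at hX hY hYY
  have hsh := congrArg Prod.fst hX
  have hXV := congrArg (fun p : Carrier (k + 1) => p.2.2) hX
  have hYV := congrArg (fun p : Carrier (k + 1) => p.2.2) hY
  have hYYV := congrArg (fun p : Carrier (k + 1) => p.2.2) hYY
  simp [chain, gen] at hsh hXV hYV hYYV
  have h0 : j.1 0 = 0 := congrFun hsh 1
  -- With a nonzero Y component, centrality forces C = D = 0 and makes B a multiple of A, so nothing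
  -- spans ℂ².
  have hs : j.2.1 = 0 := by
    by_contra hs
    simp [h0, hs] at hYV hYYV
    have hB : q.B = (-(j.1 (Fin.last _) / j.2.1)) • q.A := by
      have : j.2.1 • q.B = -(j.1 (Fin.last _) • q.A) := by
        rw [eq_neg_iff_add_eq_zero, add_comm]; exact hXV
      rw [neg_smul, div_eq_inv_mul, mul_smul, ← smul_neg, ← this, inv_smul_smul₀ hs]
    rcases hq with h | h | h | h | h | h <;> simp [det, hYV, hYYV, hB] at h
    exact h (by ring)
  rw [eq_sum_chain j, Fin.sum_univ_succ, h0, hs]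
  refine I.add_mem (I.add_mem (I.add_mem ?_ (I.sum_mem fun i _ => I.smul_mem _ ?_)) ?_) (hV _)
  · simp
  · rw [← chain_succ q]; exact prod _ _
  · simp

theorem det_self (P : ℂ × ℂ) : det P P = 0 := by unfold det; ring

theorem det_neg_swap (P Q : ℂ × ℂ) : det Q P = -det P Q := by unfold det; ring

theorem Quad.exists_functional {q : Quad} (hq : ¬ q.Spans) :
    ∃ w : ℂ × ℂ, w ≠ 0 ∧ det w q.A = 0 ∧ det w q.B = 0 ∧ det w q.C = 0 ∧ det w q.D = 0 := by
  simp only [Quad.Spans, not_or, not_not] at hq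
  obtain ⟨h1, h2, h3, h4, h5, h6⟩ := hq
  by_cases hA : q.A = 0
  · by_cases hB : q.B = 0
    · by_cases hC : q.C = 0
      · by_cases hD : q.D = 0
        · exact ⟨(1, 0), by simp, by simp [hA, hB, hC, hD, det]⟩
        · exact ⟨q.D, hD, by simp [hA, hB, hC, det_self]; simp [det]⟩
      · exact ⟨q.C, hC, by simp [hA, hB, h6, det_self]; simp [det]⟩
    · exact ⟨q.B, hB, by simp [hA, h4, h5, det_self]; simp [det]⟩
  · exact ⟨q.A, hA, by simp [h1, h2, h3, det_self]⟩

/-- If A, B, C, D lie on one line ℂw, the functional det(w, ·) vanishes on all products. Its kernel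
is then an ideal, and any central line on which it is nonzero is an abelian complement. -/
theorem Quad.spans_of_not_isSplit {k : ℕ} {q : Quad} (h : ¬ IsSplit (q.model k)) : q.Spans := by
  by_contra hq
  obtain ⟨w, hw, hA, hB, hC, hD⟩ := Quad.exists_functional hq
  obtain ⟨v₀, hv₀⟩ : ∃ v, det w v = 1 := by
    by_cases h1 : w.1 = 0
    · have h2 : w.2 ≠ 0 := fun h2 => hw (Prod.ext h1 h2)
      exact ⟨(-(w.2)⁻¹, 0), by simp [det, h2]⟩
    · exact ⟨(0, (w.1)⁻¹), by simp [det, h1]⟩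
  let ℓ : Carrier k →ₗ[ℂ] ℂ :=
    { toFun p := det w p.2.2
      map_add' x y := by simp [det]; ring
      map_smul' c x := by simp [det]; ring }
  have hℓ (x y) : ℓ (q.model k x y) = 0 := by
    change det w _ = 0
    unfold det at *
    simp [Quad.model_apply]
    linear_combination y.1 0 * x.1 (Fin.last k) * hA + y.1 0 * x.2.1 * hB +
      y.2.1 * x.1 0 * hC + y.2.1 * x.2.1 * hD
  have hJ (t : ℂ) (y : Carrier k) :
      q.model k (t • (0, 0, v₀)) y = 0 ∧ q.model k y (t • (0, 0, v₀)) = 0 := by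
    simp [Quad.model_apply]
  refine h ⟨LinearMap.ker ℓ, ℂ ∙ ((0, 0, v₀) : Carrier k), fun x _ y => ⟨hℓ x y, hℓ y x⟩, ?_,
    ?_, ?_, ?_⟩
  · intro x hx y
    obtain ⟨t, rfl⟩ := Submodule.mem_span_singleton.1 hx
    rw [(hJ t y).1, (hJ t y).2]
    simp
  · have hv : ℓ (0, 0, v₀) = 1 := hv₀
    refine ⟨Submodule.disjoint_def.2 fun x hx hx' => ?_,
      codisjoint_iff.2 (eq_top_iff.2 fun x _ => ?_)⟩
    · obtain ⟨t, rfl⟩ := Submodule.mem_span_singleton.1 hx'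
      rw [LinearMap.mem_ker, map_smul, hv, smul_eq_mul, mul_one] at hx
      rw [hx, zero_smul]
    · refine Submodule.mem_sup.2 ⟨x - ℓ x • (0, 0, v₀), ?_, ℓ x • (0, 0, v₀),
        Submodule.mem_span_singleton.2 ⟨_, rfl⟩, sub_add_cancel _ _⟩
      rw [LinearMap.mem_ker, map_sub, map_smul, hv, smul_eq_mul, mul_one, sub_self]
  · rw [Ne, Submodule.span_singleton_eq_bot]
    intro h0
    have : v₀ = 0 := by simpa using h0
    simp [this, det] at hv₀
  · intro x hx y _
    obtain ⟨t, rfl⟩ := Submodule.mem_span_singleton.1 hx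
    exact (hJ t y).1

theorem shift_single {k : ℕ} (i : Fin k) :
    shift k (Pi.single i.castSucc 1) = Pi.single i.succ 1 := by
  ext l
  refine Fin.cases ?_ (fun l => ?_) l
  · simp
  · simp [Pi.single_apply]

/-! ### Reduction of an arbitrary extension to a model -/

section Extension

variable {H : Type*} [AddCommGroup H] [Module ℂ H] {br : Product H}

/-- The left-normed powers of an element. -/
def leftPow (br : Product H) (x : H) : ℕ → H
  | 0 => x
  | i + 1 => br (leftPow br x i) x

/-- Taking y = z in the Leibniz identity shows that squares annihilate from the right; the identity
propagates this to higher powers. -/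
theorem IsLeibniz.bracket_leftPow_succ (h : IsLeibniz br) (x : H) (i : ℕ) (z : H) :
    br z (leftPow br x (i + 1)) = 0 := by
  induction i generalizing z with
  | zero => simp [leftPow, h z x x]
  | succ i ih => rw [leftPow, h, ih, ih, map_zero, LinearMap.zero_apply, sub_self]

theorem IsCentralExtension.exists_model {k : ℕ} {ε : ℂ × ℂ →ₗ[ℂ] H}
    {π : H →ₗ[ℂ] (Fin (k + 1) → ℂ) × ℂ} (h : IsCentralExtension br (base k) ε π) :
    ∃ q : Quad, Isomorphic br (q.model k) := by
  obtain ⟨x, hx⟩ := h.surjective (Pi.single 0 1, 0)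
  obtain ⟨y, hy⟩ := h.surjective (0, 1)
  have mem_range {z : H} (hz : π z = 0) : ∃ v, z = ε v := by
    have : z ∈ LinearMap.range ε := by rw [h.exact]; exact hz
    obtain ⟨v, hv⟩ := this
    exact ⟨v, hv.symm⟩
  have πε (v) : π (ε v) = 0 := by
    have : ε v ∈ LinearMap.ker π := by rw [← h.exact]; exact ⟨v, rfl⟩
    exact this
  set X := leftPow br x with hX
  have X0 : X 0 = x := rfl
  have Xs (i) : X (i + 1) = br (X i) x := rfl
  have πX (i : Fin (k + 1)) : π (X i) = (Pi.single i 1, 0) := by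
    induction i using Fin.induction with
    | zero => exact hx
    | succ i ih =>
      rw [Fin.val_succ, Xs, h.map_bracket, hx, base_apply]
      rw [Fin.val_castSucc] at ih
      rw [ih, shift_single]
      simp
  obtain ⟨A, hA⟩ : ∃ v, X (k + 1) = ε v := by
    apply mem_range
    have := πX (Fin.last k)
    rw [Fin.val_last] at this
    rw [Xs, h.map_bracket, this, base_apply, shift_last]
    simp
  obtain ⟨B, hB⟩ : ∃ v, br y x = ε v := mem_range (by rw [h.map_bracket, hx, hy]; simp)
  obtain ⟨C, hC⟩ : ∃ v, br x y = ε v := mem_range (by rw [h.map_bracket, hx, hy]; simp)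
  obtain ⟨D, hD⟩ : ∃ v, br y y = ε v := mem_range (by rw [h.map_bracket, hy]; simp)
  -- Leibniz gives [[X_i, x], y] = [X_i, [x, y]] + [[X_i, y], x], and both inner brackets are
  -- central.
  have Xy (i : ℕ) : br (X (i + 1)) y = 0 := by
    obtain ⟨v, hv⟩ : ∃ v, br (X i) y = ε v := mem_range (by rw [h.map_bracket, hy]; simp)
    have := h.leibniz_total (X i) x y
    rw [hC, hv, (h.central _ _).1, (h.central _ _).2, sub_zero] at this
    exact this.symm
  let Φ : Carrier k →ₗ[ℂ] H :=
    { toFun p := ∑ i, p.1 i • X (i : ℕ) + p.2.1 • y + ε p.2.2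
      map_add' p q := by
        simp only [Prod.fst_add, Prod.snd_add, Pi.add_apply, add_smul, Finset.sum_add_distrib,
          map_add]
        abel
      map_smul' c p := by
        simp [mul_smul, Finset.smul_sum] }
  have hΦ (p) : Φ p = ∑ i, p.1 i • X (i : ℕ) + p.2.1 • y + ε p.2.2 := rfl
  have πΦ (p) : π (Φ p) = (p.1, p.2.1) := by
    rw [hΦ]
    simp only [map_add, map_sum, map_smul, πX, hy, πε]
    refine Prod.ext (funext fun i => ?_) ?_
    · simp [Prod.fst_sum, Finset.sum_apply, Pi.single_apply]
    · simp [Prod.snd_sum]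
  have bij : Function.Bijective Φ := by
    constructor
    · rw [injective_iff_map_eq_zero]
      rintro ⟨u, s, v⟩ hp
      have h1 := πΦ (u, s, v)
      rw [hp, map_zero] at h1
      obtain ⟨hu, hs⟩ := Prod.ext_iff.1 h1
      dsimp at hu hs
      subst hu hs
      rw [hΦ] at hp
      simp only [Pi.zero_apply, zero_smul, Finset.sum_const_zero, zero_add] at hp
      rw [map_eq_zero_iff ε h.injective] at hp
      rw [hp]
      rfl
    · intro z
      obtain ⟨v, hv⟩ := mem_range (z := z - Φ ((π z).1, (π z).2, 0)) (by
        rw [map_sub, πΦ]; simp)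
      refine ⟨((π z).1, (π z).2, v), ?_⟩
      rw [hΦ] at hv ⊢
      simp only [map_zero, add_zero] at hv ⊢
      rw [← hv]
      abel
  have right (z : H) (p) : br z (Φ p) = p.1 0 • br z x + p.2.1 • br z y := by
    rw [hΦ, Fin.sum_univ_succ]
    simp only [map_add, map_sum, map_smul, Fin.val_succ, hX,
      h.leibniz_total.bracket_leftPow_succ, (h.central _ _).2]
    simp [leftPow]
  have leftx (p) : br (Φ p) x =
      ∑ i : Fin k, p.1 i.castSucc • X (i + 1) + p.1 (Fin.last k) • ε A + p.2.1 • ε B := by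
    rw [hΦ]
    simp only [map_add, map_sum, map_smul, LinearMap.add_apply, LinearMap.sum_apply,
      LinearMap.smul_apply, ← Xs, hB, (h.central _ _).1]
    rw [Fin.sum_univ_castSucc]
    simp [hA]
  have lefty (p) : br (Φ p) y = p.1 0 • ε C + p.2.1 • ε D := by
    rw [hΦ, Fin.sum_univ_succ]
    simp only [map_add, map_sum, map_smul, LinearMap.add_apply, LinearMap.sum_apply,
      LinearMap.smul_apply, Fin.val_succ, Xy, hD, (h.central _ _).1]
    simp [X0, hC]
  refine ⟨⟨A, B, C, D⟩, Isomorphic.symm ⟨LinearEquiv.ofBijective Φ bij, fun p q => ?_⟩⟩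
  simp only [LinearEquiv.ofBijective_apply]
  rw [right, leftx, lefty, hΦ, Fin.sum_univ_succ]
  simp only [Quad.model_apply, Pi.smul_apply, shift_zero, shift_succ, Fin.val_succ, map_add,
    map_smul, smul_add, Finset.smul_sum, smul_eq_mul, mul_smul, mul_zero, zero_smul]
  abel

theorem IsCentralExtension.comp_equiv {V W L : Type*} [AddCommGroup V] [Module ℂ V]
    [AddCommGroup W] [Module ℂ W] [AddCommGroup L] [Module ℂ L] {brL : Product L}
    {ε : V →ₗ[ℂ] H} {π : H →ₗ[ℂ] L} (h : IsCentralExtension br brL ε π) (φ : W ≃ₗ[ℂ] V) :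
    IsCentralExtension br brL (ε ∘ₗ φ.toLinearMap) π where
  leibniz_total := h.leibniz_total
  leibniz_base := h.leibniz_base
  map_bracket := h.map_bracket
  injective := h.injective.comp φ.injective
  exact := by rw [LinearEquiv.range_comp, h.exact]
  surjective := h.surjective
  central v x := h.central (φ v) x

theorem IsCentralExtension.exists_model_of_F2 {k : ℕ} {V : Type*} [AddCommGroup V] [Module ℂ V]
    {ε : V →ₗ[ℂ] H} {π : H →ₗ[ℂ] (Fin (k + 2) → ℂ)} (hV : Module.finrank ℂ V = 2)
    (h : IsCentralExtension br (F2 (k + 2)) ε π) : ∃ q : Quad, Isomorphic br (q.model k) := by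
  have : FiniteDimensional ℂ V := Module.finite_of_finrank_pos (by omega)
  obtain ⟨ψ, hψ⟩ := F2_isomorphic_base k
  let φ : (ℂ × ℂ) ≃ₗ[ℂ] V := LinearEquiv.ofFinrankEq _ _ (by simp [hV])
  exact ((h.comp_equiv φ).of_isomorphic (LinearEquiv.refl ℂ H) (fun _ _ => rfl) ψ
    hψ).exists_model

end Extension

/-! ### The listed algebras as models -/

/-- Coordinates on `ℂ^{k+4}` in which the chain is `e_1, …, e_{k+1}`, the additional generator
is `e_{y+1}` and the central plane is spanned by `e_{p+1}` and `e_{r+1}`. -/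
def coord (k : ℕ) (y p r : Fin (k + 2 + 2)) : (Fin (k + 2 + 2) → ℂ) →ₗ[ℂ] Carrier k :=
  (LinearMap.funLeft ℂ ℂ (Fin.castLE (by omega))).prod
    ((LinearMap.proj y).prod ((LinearMap.proj p).prod (LinearMap.proj r)))

theorem coord_e {k j : ℕ} (y p r : Fin (k + 2 + 2)) : coord k y p r (e (k + 2 + 2) j) =
    (fun i : Fin (k + 1) => if (i : ℕ) + 1 = j then 1 else 0, if (y : ℕ) + 1 = j then 1 else 0,
      if (p : ℕ) + 1 = j then 1 else 0, if (r : ℕ) + 1 = j then 1 else 0) := rfl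

theorem coord_injective {k : ℕ} {y p r : Fin (k + 2 + 2)}
    (h : ∀ i : Fin (k + 2 + 2), (i : ℕ) < k + 1 ∨ i = y ∨ i = p ∨ i = r) :
    Function.Injective (coord k y p r) := by
  rw [injective_iff_map_eq_zero]
  intro x hx
  ext i
  rcases h i with h | rfl | rfl | rfl
  · exact congrFun (congrArg Prod.fst hx) ⟨i, h⟩
  · exact congrArg (fun p : Carrier k => p.2.1) hx
  · exact congrArg (fun p : Carrier k => p.2.2.1) hx
  · exact congrArg (fun p : Carrier k => p.2.2.2) hx

/-- A multiplication table of the shape of the listed algebras is a model. -/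
theorem isomorphic_model_of_table {k : ℕ} {y p r : Fin (k + 2 + 2)}
    (h : ∀ i : Fin (k + 2 + 2), (i : ℕ) < k + 1 ∨ i = y ∨ i = p ∨ i = r)
    (hy : k < y) (hp : k < p) (hr : k < r) (hyp : y ≠ p) (hyr : y ≠ r) (hpr : p ≠ r)
    {t : ℕ → ℕ → Fin (k + 2 + 2) → ℂ} {q : Quad}
    (hX : ∀ i : ℕ, 1 ≤ i → i ≤ k → t i 1 = e _ (i + 1))
    (hA : t (k + 1) 1 = q.A.1 • e _ (p + 1) + q.A.2 • e _ (r + 1))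
    (hB : t (y + 1) 1 = q.B.1 • e _ (p + 1) + q.B.2 • e _ (r + 1))
    (hC : t 1 (y + 1) = q.C.1 • e _ (p + 1) + q.C.2 • e _ (r + 1))
    (hD : t (y + 1) (y + 1) = q.D.1 • e _ (p + 1) + q.D.2 • e _ (r + 1))
    (h0 : ∀ i j : ℕ, j ≠ 1 → j ≠ y + 1 → t i j = 0)
    (hp1 : t (p + 1) 1 = 0) (hr1 : t (r + 1) 1 = 0)
    (hyi : ∀ i : ℕ, i ≠ 1 → i ≠ y + 1 → t i (y + 1) = 0) :
    Isomorphic (ofTable (k + 2 + 2) t) (q.model k) := by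
  have hyp' : (y : ℕ) ≠ p := fun h => hyp (Fin.ext h)
  have hyr' : (y : ℕ) ≠ r := fun h => hyr (Fin.ext h)
  have hpr' : (p : ℕ) ≠ r := fun h => hpr (Fin.ext h)
  have ey : coord k y p r (e _ (y + 1)) = (0, 1, 0) := by
    rw [coord_e]
    refine Prod.ext (funext fun l => ?_) ?_
    · have := l.2
      simp
      omega
    · simp [Ne.symm hyp', Ne.symm hyr']
  have ep : coord k y p r (e _ (p + 1)) = (0, 0, 1, 0) := by
    rw [coord_e]
    refine Prod.ext (funext fun l => ?_) ?_
    · have := l.2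
      simp
      omega
    · simp [hyp', Ne.symm hpr']
  have er : coord k y p r (e _ (r + 1)) = (0, 0, 0, 1) := by
    rw [coord_e]
    refine Prod.ext (funext fun l => ?_) ?_
    · have := l.2
      simp
      omega
    · simp [hpr', hyr']
  have ex (i : Fin (k + 1)) : coord k y p r (e _ (i + 1)) = chain k i := by
    have := i.2
    rw [coord_e]
    refine Prod.ext (funext fun l => ?_) ?_
    · simp [chain, Pi.single_apply, Fin.ext_iff]
    · simp [chain]
      omega
  have ex0 : coord k y p r (e _ (0 + 1)) = chain k 0 := ex 0
  refine isomorphic_ofTable (coord k y p r) (coord_injective h) (by simp) ?_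
  intro i j hi hj
  by_cases hj1 : j = 0
  · subst hj1
    rw [ex0]
    rcases h ⟨i, hi⟩ with h | h | h | h
    · dsimp at h
      rw [ex ⟨i, h⟩]
      rcases Nat.lt_succ_iff_lt_or_eq.1 h with h' | rfl
      · rw [hX _ (by omega) (by omega)]
        have := ex (Fin.succ ⟨i, h'⟩)
        simp only [Fin.val_succ] at this
        rw [this, ← chain_succ q]
        rfl
      · rw [show (⟨i, h⟩ : Fin (i + 1)) = Fin.last i from rfl, chain_last, hA]
        simp [ep, er]
    · obtain rfl : i = y := congrArg Fin.val h
      rw [hB, ey, show ((0, 1, 0) : Carrier k) = gen k from rfl, gen_chain]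
      simp [ep, er]
    · obtain rfl : i = p := congrArg Fin.val h
      rw [hp1, ep]
      simp [Quad.model_apply]
      rfl
    · obtain rfl : i = r := congrArg Fin.val h
      rw [hr1, er]
      simp [Quad.model_apply]
      rfl
  · by_cases hjy : j = y
    · subst hjy
      rw [ey, show ((0, 1, 0) : Carrier k) = gen k from rfl]
      by_cases hi0 : i = 0
      · subst hi0
        rw [ex0, chain_gen, hC]
        simp [ep, er]
      · by_cases hiy : i = y
        · subst hiy
          rw [ey, show ((0, 1, 0) : Carrier k) = gen k from rfl, gen_gen, hD]
          simp [ep, er]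
        · rw [hyi _ (by omega) (by omega), coord_e]
          simp [Quad.model_apply, gen, Ne.symm hiy, Ne.symm hi0]
          rfl
    · rw [h0 _ _ (by omega) (by omega), coord_e (j := j + 1)]
      simp [Quad.model_apply, Ne.symm hjy, Ne.symm hj1]
      rfl

/-- The structure constants of the listed algebras. -/
def Entry.quad : Entry → Quad
  | .N1000 => ⟨(1, 0), (0, 1), (1, 0), (0, 0)⟩
  | .N01 β₃ _ => ⟨(1, 0), (0, 1), (0, β₃), (1, 0)⟩
  | .N1001 => ⟨(1, 0), (0, 1), (1, 0), (0, 1)⟩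
  | .N0100 => ⟨(1, 0), (0, 1), (0, 0), (1, 0)⟩
  | .N0111 => ⟨(1, 0), (0, 1), (0, 1), (1, 1)⟩
  | .R0010 => ⟨(0, 0), (1, 0), (0, 1), (0, 0)⟩
  | .R0011 => ⟨(0, 0), (1, 0), (0, 1), (0, 1)⟩
  | .R011 β₄ => ⟨(0, 0), (1, 0), (0, 1), (1, β₄)⟩
  | .R1001 => ⟨(0, 0), (1, 0), (1, 0), (0, 1)⟩
  | .L1 lam => ⟨(1, 0), (0, 1), (0, lam), (0, 0)⟩
  | .L2 lam _ => ⟨(1, 0), (0, 1), (0, lam), (0, 1)⟩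
  | .Lsq => ⟨(1, 0), (0, 0), (0, 1), (0, 0)⟩
  | .Nstar => ⟨(1, 0), (0, 0), (0, 1), (1, 0)⟩

theorem N_isomorphic (k : ℕ) (α₃ α₄ β₃ β₄ : ℂ) : Isomorphic (N (k + 2) α₃ α₄ β₃ β₄)
    (Quad.model k ⟨(1, 0), (0, 1), (α₃, β₃), (α₄, β₄)⟩) := by
  apply isomorphic_model_of_table (y := ⟨k + 2, by omega⟩) (p := ⟨k + 1, by omega⟩)
    (r := ⟨k + 3, by omega⟩)
  all_goals (simp [Fin.ext_iff])
  all_goals first | done | (intros; split_ifs <;> first | rfl | omega) | omega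

theorem R_isomorphic (k : ℕ) (α₃ α₄ β₃ β₄ : ℂ) : Isomorphic (R (k + 2) α₃ α₄ β₃ β₄)
    (Quad.model k ⟨(0, 0), (1, 0), (α₃, β₃), (α₄, β₄)⟩) := by
  apply isomorphic_model_of_table (y := ⟨k + 1, by omega⟩) (p := ⟨k + 2, by omega⟩)
    (r := ⟨k + 3, by omega⟩)
  all_goals (simp [Fin.ext_iff])
  all_goals first | done | (intros; split_ifs <;> first | rfl | omega) | omega

theorem L1_isomorphic (k : ℕ) (lam : ℂ) : Isomorphic (L1 (k + 2 + 2) lam)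
    (Quad.model k ⟨(1, 0), (0, 1), (0, lam), (0, 0)⟩) := by
  apply isomorphic_model_of_table (y := ⟨k + 2, by omega⟩) (p := ⟨k + 1, by omega⟩)
    (r := ⟨k + 3, by omega⟩)
  all_goals (simp [Fin.ext_iff])
  all_goals first | done | (intros; split_ifs <;> first | rfl | omega) | omega

theorem L2_isomorphic (k : ℕ) (lam : ℂ) : Isomorphic (L2 (k + 2 + 2) lam)
    (Quad.model k ⟨(1, 0), (0, 1), (0, lam), (0, 1)⟩) := by
  apply isomorphic_model_of_table (y := ⟨k + 2, by omega⟩) (p := ⟨k + 1, by omega⟩)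
    (r := ⟨k + 3, by omega⟩)
  all_goals (simp [Fin.ext_iff])
  all_goals first | done | (intros; split_ifs <;> first | rfl | omega) | omega

theorem Lsq_isomorphic (k : ℕ) : Isomorphic (Lsq (k + 2 + 2))
    (Quad.model k ⟨(1, 0), (0, 0), (0, 1), (0, 0)⟩) := by
  apply isomorphic_model_of_table (y := ⟨k + 2, by omega⟩) (p := ⟨k + 1, by omega⟩)
    (r := ⟨k + 3, by omega⟩)
  all_goals (simp [Fin.ext_iff])
  all_goals first | done | (intros; split_ifs <;> first | rfl | omega) | omega

theorem Nstar_isomorphic (k : ℕ) : Isomorphic (Nstar (k + 2))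
    (Quad.model k ⟨(1, 0), (0, 0), (0, 1), (1, 0)⟩) := by
  apply isomorphic_model_of_table (y := ⟨k + 2, by omega⟩) (p := ⟨k + 1, by omega⟩)
    (r := ⟨k + 3, by omega⟩)
  all_goals (simp [Fin.ext_iff])
  all_goals first | done | (intros; split_ifs <;> first | rfl | omega) | omega

theorem Entry.isomorphic_model (k : ℕ) (a : Entry) :
    Isomorphic (a.algebra (k + 2)) (a.quad.model k) := by
  cases a
  case L1 lam => exact L1_isomorphic k lam
  case L2 lam h => exact L2_isomorphic k lam
  case Lsq => exact Lsq_isomorphic k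
  case Nstar => exact Nstar_isomorphic k
  case R0010 => exact R_isomorphic k 0 0 1 0
  case R0011 => exact R_isomorphic k 0 0 1 1
  case R011 β₄ => exact R_isomorphic k 0 1 1 β₄
  case R1001 => exact R_isomorphic k 1 0 0 1
  case N1000 => exact N_isomorphic k 1 0 0 0
  case N01 β₃ h => exact N_isomorphic k 0 1 β₃ 0
  case N1001 => exact N_isomorphic k 1 0 0 1
  case N0100 => exact N_isomorphic k 0 1 0 0
  case N0111 => exact N_isomorphic k 0 1 1 1

theorem Entry.spans (a : Entry) : a.quad.Spans := by
  cases a <;> simp [Quad.Spans, Entry.quad, det]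

/-! ### Pairwise non-isomorphism -/

/-- Two independent linear relations between the structure constants of a listed algebra. -/
def Entry.relations : Entry → (ℂ × ℂ × ℂ × ℂ) × (ℂ × ℂ × ℂ × ℂ)
  | .N1000 => ((1, 0, -1, 0), (0, 0, 0, -1))
  | .N01 β₃ _ => ((0, β₃, -1, 0), (1, 0, 0, -1))
  | .N1001 => ((1, 0, -1, 0), (0, 1, 0, -1))
  | .N0100 => ((0, 0, -1, 0), (1, 0, 0, -1))
  | .N0111 => ((0, 1, -1, 0), (1, 1, 0, -1))
  | .R0010 => ((1, 0, 0, 0), (0, 0, 0, -1))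
  | .R0011 => ((1, 0, 0, 0), (0, 0, 1, -1))
  | .R011 β₄ => ((1, 0, 0, 0), (0, 1, β₄, -1))
  | .R1001 => ((1, 0, 0, 0), (0, 1, -1, 0))
  | .L1 lam => ((0, lam, -1, 0), (0, 0, 0, -1))
  | .L2 lam _ => ((0, lam, -1, 0), (0, 1, 0, -1))
  | .Lsq => ((0, 1, 0, 0), (0, 0, 0, -1))
  | .Nstar => ((0, 1, 0, 0), (1, 0, 0, -1))

theorem Entry.relations_hold (x : Entry) :
    (x.relations.1.1 • x.quad.A + x.relations.1.2.1 • x.quad.B + x.relations.1.2.2.1 • x.quad.C +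
      x.relations.1.2.2.2 • x.quad.D = 0) ∧
    (x.relations.2.1 • x.quad.A + x.relations.2.2.1 • x.quad.B + x.relations.2.2.2.1 • x.quad.C +
      x.relations.2.2.2.2 • x.quad.D = 0) := by
  cases x <;> simp [Entry.relations, Entry.quad]

/-- Transporting the relations of each algebra to the other gives polynomial equations in a, b, d, f
and their primed counterparts. With a, d ≠ 0 these are contradictory for different entries and force
equal parameters within a family. -/
theorem Entry.eq_of_isomorphic {k : ℕ} (hk : 2 ≤ k) {x y : Entry}
    (h : Isomorphic (x.quad.model k) (y.quad.model k)) : x = y := by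
  obtain ⟨a, b, d, f, ha, hd, H⟩ := Quad.relations_of_isomorphic hk x.spans h
  obtain ⟨a', b', d', f', ha', hd', H'⟩ := Quad.relations_of_isomorphic hk y.spans h.symm
  have h1 := H _ _ _ _ x.relations_hold.1
  have h2 := H _ _ _ _ x.relations_hold.2
  have h3 := H' _ _ _ _ y.relations_hold.1
  have h4 := H' _ _ _ _ y.relations_hold.2
  clear H H' h
  cases x <;> cases y <;> simp [Entry.relations, Entry.quad, ha, hd, ha', hd'] at h1 h2 h3 h4 ⊢
  all_goals (try grind)

/-! ### Normal forms under change of generators -/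

/-- The structure constants of `N(α₃, α₄, β₃, β₄)`. -/
def Quad.ofN (α₃ α₄ β₃ β₄ : ℂ) : Quad := ⟨(1, 0), (0, 1), (α₃, β₃), (α₄, β₄)⟩

theorem Quad.ofN_isomorphic {k : ℕ} (hk : 2 ≤ k) {α₃ α₄ β₃ β₄ α₃' α₄' β₃' β₄' : ℂ}
    (a b d g : ℂ) (ha : a ≠ 0) (hd : d ≠ 0) (ht : a + b * β₄ ≠ 0)
    (h₁ : α₃' * a ^ (k + 2) + β₃' * g = d * (a * α₃ + b * α₄))
    (h₂ : β₃' * (a + b * β₄) = a * β₃ + b * β₄)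
    (h₃ : α₄' * a ^ (k + 2) + β₄' * g = d ^ 2 * α₄)
    (h₄ : β₄' * (a + b * β₄) = d * β₄) :
    Isomorphic ((Quad.ofN α₃ α₄ β₃ β₄).model k) ((Quad.ofN α₃' α₄' β₃' β₄').model k) := by
  -- P and Q are the new A and B, as the normal form demands. The first coordinate g of Q serves as
  -- the free parameter, and f is solved from g = bdα₄ + af.
  refine Quad.isomorphic_of_change hk (a := a) (b := b) (d := d) (f := (g - b * d * α₄) / a)
    (P := (a ^ (k + 2), 0)) (Q := (g, d * (a + b * β₄))) ha hd ?_ ?_ ?_ ?_ ?_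
  · simp [det, ha, hd, ht]
  · simp [Quad.ofN]
  · ext
    · simp [Quad.ofN]; field_simp; ring
    · simp [Quad.ofN]; ring
  · ext
    · simp [Quad.ofN]; linear_combination h₁
    · simp [Quad.ofN]; linear_combination d * h₂
  · ext
    · simp [Quad.ofN]; linear_combination h₃
    · simp [Quad.ofN]; linear_combination d * h₄

/-- When β₄ = 0, β₃ is invariant, while b, d, g normalise α₃ and α₄. When β₄ ≠ 0, d makes β₄ equal
to 1; the value β₃ = 1 is fixed, and any other β₃ is moved to 0 by b = -aβ₃/β₄. One determinant-like
quantity then remains: it is zero, or is scaled to 1 by a k-th root a. -/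
theorem Quad.exists_entry_ofN {k : ℕ} (hk : 2 ≤ k) (α₃ α₄ β₃ β₄ : ℂ) :
    ∃ x : Entry, Isomorphic ((Quad.ofN α₃ α₄ β₃ β₄).model k) (x.quad.model k) := by
  have root {n : ℕ} (hn : 0 < n) {w : ℂ} (hw : w ≠ 0) : ∃ z : ℂ, z ≠ 0 ∧ z ^ n = w := by
    obtain ⟨z, hz⟩ := IsAlgClosed.exists_pow_nat_eq w hn
    exact ⟨z, by rintro rfl; exact hw (by rw [← hz, zero_pow hn.ne']), hz⟩
  by_cases hβ₄ : β₄ = 0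
  · subst hβ₄
    by_cases hα₄ : α₄ = 0
    · subst hα₄
      by_cases hβ₃ : β₃ = 0
      · subst hβ₃
        by_cases hα₃ : α₃ = 0
        · subst hα₃
          exact ⟨.L1 0, Quad.ofN_isomorphic hk 1 0 1 0 one_ne_zero one_ne_zero (by simp)
            (by simp) (by simp) (by simp) (by simp)⟩
        · exact ⟨.N1000, Quad.ofN_isomorphic hk 1 0 α₃⁻¹ 0 one_ne_zero (inv_ne_zero hα₃) (by simp)
            (by simp [hα₃]) (by simp) (by simp) (by simp)⟩
      · exact ⟨.L1 β₃, Quad.ofN_isomorphic hk 1 0 1 (α₃ / β₃) one_ne_zero one_ne_zero (by simp)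
          (by simp; field_simp) (by simp) (by simp) (by simp)⟩
    · obtain ⟨d, hd, hd2⟩ := root two_pos (inv_ne_zero hα₄)
      have hd3 : d ^ 2 * α₄ = 1 := by rw [hd2, inv_mul_cancel₀ hα₄]
      by_cases hβ₃ : β₃ = 0
      · subst hβ₃
        exact ⟨.N0100, Quad.ofN_isomorphic hk 1 (-α₃ / α₄) d 0 one_ne_zero hd (by simp)
          (by field_simp; ring) (by simp) (by simp [hd3]) (by simp)⟩
      · exact ⟨.N01 β₃ hβ₃, Quad.ofN_isomorphic hk 1 0 d (d * α₃ / β₃) one_ne_zero hd (by simp)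
          (by field_simp; ring) (by simp) (by simp [hd3]) (by simp)⟩
  · by_cases hβ₃ : β₃ = 1
    · subst hβ₃
      by_cases hw : α₄ - α₃ * β₄ = 0
      · obtain rfl : α₄ = α₃ * β₄ := sub_eq_zero.1 hw
        exact ⟨.L2 1 (.inr rfl), Quad.ofN_isomorphic hk 1 0 β₄⁻¹ (α₃ / β₄) one_ne_zero
          (inv_ne_zero hβ₄) (by simp) (by field_simp; ring) (by simp) (by field_simp; ring)
          (by field_simp; ring)⟩
      · obtain ⟨a, ha, hak⟩ := root (n := k) (by omega)
          (div_ne_zero hw (pow_ne_zero 2 hβ₄))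
        refine ⟨.N0111, Quad.ofN_isomorphic hk a 0 (a / β₄) (a / β₄ * (a * α₃)) ha
          (div_ne_zero ha hβ₄) (by simpa using ha) (by ring) (by ring) ?_ (by field_simp; ring)⟩
        rw [pow_add, hak]
        field_simp
        ring
    · have h1 : 1 - β₃ ≠ 0 := sub_ne_zero.2 (Ne.symm hβ₃)
      by_cases hw : α₃ * β₄ - β₃ * α₄ = 0
      · refine ⟨.L2 0 (.inl rfl), Quad.ofN_isomorphic hk 1 (-β₃ / β₄) ((1 - β₃) / β₄)
          (((1 - β₃) / β₄) ^ 2 * α₄) one_ne_zero (div_ne_zero h1 hβ₄) ?_ ?_ ?_ ?_ ?_⟩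
        · rw [div_mul_cancel₀ _ hβ₄]; simpa [← sub_eq_add_neg] using h1
        · field_simp
          linear_combination -(1 - β₃) * hw
        · field_simp; ring
        · ring
        · field_simp; ring
      · obtain ⟨a, ha, hak⟩ := root (n := k) (by omega)
          (div_ne_zero (mul_ne_zero h1 hw) (pow_ne_zero 2 hβ₄))
        refine ⟨.N1001, Quad.ofN_isomorphic hk a (-a * β₃ / β₄) (a * (1 - β₃) / β₄)
          ((a * (1 - β₃) / β₄) ^ 2 * α₄) ha (div_ne_zero (mul_ne_zero ha h1) hβ₄) ?_ ?_ ?_ ?_ ?_⟩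
        · rw [div_mul_cancel₀ _ hβ₄]
          have : a + -a * β₃ = a * (1 - β₃) := by ring
          rw [this]
          exact mul_ne_zero ha h1
        · rw [pow_add, hak]; field_simp; ring
        · field_simp; ring
        · ring
        · field_simp; ring

theorem det_add_right (P Q R : ℂ × ℂ) : det P (Q + R) = det P Q + det P R := by
  simp [det]; ring

theorem Quad.exists_entry_of_det_ne_zero {k : ℕ} (hk : 2 ≤ k) {q : Quad} (h : det q.A q.B ≠ 0) :
    ∃ x : Entry, Isomorphic (q.model k) (x.quad.model k) := by
  obtain ⟨α₃, β₃, hC⟩ := exists_eq_of_det_ne_zero h q.C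
  obtain ⟨α₄, β₄, hD⟩ := exists_eq_of_det_ne_zero h q.D
  obtain ⟨x, hx⟩ := Quad.exists_entry_ofN hk α₃ α₄ β₃ β₄
  refine ⟨x, Isomorphic.trans ?_ hx⟩
  exact Quad.isomorphic_of_change hk (a := 1) (b := 0) (d := 1) (f := 0) one_ne_zero one_ne_zero h
    (by simp [Quad.ofN]) (by simp [Quad.ofN]) (by simp [Quad.ofN, hC]) (by simp [Quad.ofN, hD])

theorem Quad.exists_entry_of_A_ne_zero {k : ℕ} (hk : 2 ≤ k) {q : Quad} (hq : q.Spans)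
    (hA : q.A ≠ 0) : ∃ x : Entry, Isomorphic (q.model k) (x.quad.model k) := by
  by_cases hAB : det q.A q.B = 0
  swap
  · exact Quad.exists_entry_of_det_ne_zero hk hAB
  by_cases hAD : det q.A q.D = 0
  swap
  -- Replacing X_0 by X_0 + Y adds D to B and C, which makes A and B independent.
  · obtain ⟨x, hx⟩ := Quad.exists_entry_of_det_ne_zero hk (q := ⟨q.A, q.B + q.D, q.C + q.D, q.D⟩)
      (by simpa [det_add_right, hAB] using hAD)
    refine ⟨x, Isomorphic.trans ?_ hx⟩
    refine Quad.isomorphic_of_change hk (a := 1) (b := 1) (d := 1) (f := 0) (P := (1, 0))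
      (Q := (0, 1)) one_ne_zero one_ne_zero (by simp [det]) ?_ ?_ ?_ ?_ <;> ext <;> simp
  obtain ⟨β, hB⟩ := exists_smul_of_det_eq_zero hAB hA
  obtain ⟨δ, hD⟩ := exists_smul_of_det_eq_zero hAD hA
  have hAC : det q.A q.C ≠ 0 := by
    intro h0
    obtain ⟨γ, hC⟩ := exists_smul_of_det_eq_zero h0 hA
    rcases hq with h | h | h | h | h | h <;> apply h <;> simp [hB, hC, hD, det] <;> ring
  -- Only C leaves the line of A. The parameter f removes B, and d with d²δ = 1 normalises a nonzero
  -- D.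
  by_cases hδ : δ = 0
  · refine ⟨.Lsq, Quad.isomorphic_of_change hk (a := 1) (b := 0) (d := 1) (f := -β) one_ne_zero
      one_ne_zero hAC ?_ ?_ ?_ ?_⟩ <;> simp [Entry.quad, hB, hD, hδ]
  · obtain ⟨d, hd2⟩ := IsAlgClosed.exists_pow_nat_eq δ⁻¹ two_pos
    have hd : d ≠ 0 := by
      rintro rfl
      exact inv_ne_zero hδ (by rw [← hd2, zero_pow two_ne_zero])
    refine ⟨.Nstar, Quad.isomorphic_of_change hk (a := 1) (b := 0) (d := d) (f := -(d * β))
      (P := q.A) (Q := d • q.C) one_ne_zero hd ?_ ?_ ?_ ?_ ?_⟩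
    · have : det q.A (d • q.C) = d * det q.A q.C := by simp [det]; ring
      rw [this]
      exact mul_ne_zero hd hAC
    · simp [Entry.quad]
    · simp [Entry.quad, hB, mul_smul]
    · simp [Entry.quad]
    · simp [Entry.quad, hD, smul_smul, hd2, hδ]

theorem Quad.exists_entry_of_A_eq_zero {k : ℕ} (hk : 2 ≤ k) {q : Quad} (hq : q.Spans)
    (hA : q.A = 0) : ∃ x : Entry, Isomorphic (q.model k) (x.quad.model k) := by
  by_cases hCD : det q.C q.D = 0
  · by_cases hD : q.D = 0
    · have hBC : det q.B q.C ≠ 0 := by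
        intro h0
        rcases hq with h | h | h | h | h | h <;> simp [hA, hD, det] at h
        exact h h0
      refine ⟨.R0010, Quad.isomorphic_of_change hk (a := 1) (b := 0) (d := 1) (f := 0) one_ne_zero
        one_ne_zero hBC ?_ ?_ ?_ ?_⟩ <;> simp [Entry.quad, hA, hD]
    · obtain ⟨c, hC⟩ := exists_smul_of_det_eq_zero (P := q.D) (Q := q.C)
        (by rw [det_neg_swap, hCD, neg_zero]) hD
      have hBD : det q.B q.D ≠ 0 := by
        intro h0
        rcases hq with h | h | h | h | h | h <;> apply h <;>
          simp [hA, hC, det] at h0 ⊢ <;>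
          first | ring1 | linear_combination h0 | linear_combination c * h0
      -- The choice b = 1 - c turns C = cD into D.
      refine ⟨.R0011, Quad.isomorphic_of_change hk (a := 1) (b := 1 - c) (d := 1) (f := 0)
        (P := q.B + (1 - c) • q.D) (Q := q.D) one_ne_zero one_ne_zero ?_ ?_ ?_ ?_ ?_⟩
      · convert hBD using 1
        simp [det]; ring
      · simp [Entry.quad, hA]
      · simp [Entry.quad]
      · simp [Entry.quad, hC, ← add_smul]
      · simp [Entry.quad]
  -- For B = sC + rD, shifting by b preserves s and changes r to r + b(1 - s). If s ≠ 1 this can be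
  -- made 1, so that D = B - sC for the new vectors. If s = 1, r is unaffected by b and can only be
  -- rescaled, to 1 by d = r when nonzero.
  · obtain ⟨s, r, hB⟩ := exists_eq_of_det_ne_zero hCD q.B
    by_cases hs : s = 1
    · subst hs
      by_cases hr : r = 0
      · refine ⟨.R1001, Quad.isomorphic_of_change hk (a := 1) (b := 0) (d := 1) (f := 0) one_ne_zero
          one_ne_zero hCD ?_ ?_ ?_ ?_⟩ <;> simp [Entry.quad, hA, hB, hr]
      · refine ⟨.R011 (-1), Quad.isomorphic_of_change hk (a := 1) (b := 0) (d := r) (f := 0)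
          (P := r • q.B) (Q := r • q.C) one_ne_zero hr ?_ ?_ ?_ ?_ ?_⟩
        · have : det (r • q.B) (r • q.C) = -r ^ 3 * det q.C q.D := by
            simp [det, hB]; ring
          rw [this]
          exact mul_ne_zero (neg_ne_zero.2 (pow_ne_zero 3 hr)) hCD
        · simp [Entry.quad, hA]
        · simp [Entry.quad]
        · simp [Entry.quad]
        · ext <;> simp [Entry.quad, hB] <;> ring
    · have hs' : 1 - s ≠ 0 := sub_ne_zero.2 (Ne.symm hs)
      set b := (1 - r) / (1 - s) with hb
      have hb' : b * (1 - s) = 1 - r := div_mul_cancel₀ _ hs'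
      refine ⟨.R011 (-s), Quad.isomorphic_of_change hk (a := 1) (b := b) (d := 1) (f := 0)
        (P := q.B + b • q.D) (Q := q.C + b • q.D) one_ne_zero one_ne_zero ?_ ?_ ?_ ?_ ?_⟩
      · have : det (q.B + b • q.D) (q.C + b • q.D) = -det q.C q.D := by
          simp [det, hB]
          linear_combination -(q.C.1 * q.D.2 - q.C.2 * q.D.1) * hb'
        rw [this]
        exact neg_ne_zero.2 hCD
      · simp [Entry.quad, hA]
      · simp [Entry.quad]
      · simp [Entry.quad]
      · ext
        · simp [Entry.quad, hB]
          linear_combination q.D.1 * hb'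
        · simp [Entry.quad, hB]
          linear_combination q.D.2 * hb'

theorem Quad.exists_entry {k : ℕ} (hk : 2 ≤ k) {q : Quad} (hq : q.Spans) :
    ∃ x : Entry, Isomorphic (q.model k) (x.quad.model k) := by
  by_cases hA : q.A = 0
  · exact Quad.exists_entry_of_A_eq_zero hk hq hA
  · exact Quad.exists_entry_of_A_ne_zero hk hq hA

end Leib

end

theorem theorem4p5 (n : ℕ) (hn : 4 ≤ n) :
    -- every two-dimensional non-split central extension of `F_n^2` is isomorphic to a listed algebra
    (∀ (V : Type u) (H : Type v) [AddCommGroup V] [Module ℂ V] [AddCommGroup H] [Module ℂ H]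
        (brH : Leib.Product H) (ε : V →ₗ[ℂ] H) (π : H →ₗ[ℂ] (Fin n → ℂ)),
        Module.finrank ℂ V = 2 →
        Leib.IsCentralExtension brH (Leib.F2 n) ε π →
        ¬ Leib.IsSplit brH →
        ∃ a : Leib.Entry, Leib.Isomorphic brH (a.algebra n)) ∧
    -- every listed algebra is a two-dimensional non-split central extension of `F_n^2`
    (∀ a : Leib.Entry,
        (∃ (ε : (Fin 2 → ℂ) →ₗ[ℂ] (Fin (n + 2) → ℂ)) (π : (Fin (n + 2) → ℂ) →ₗ[ℂ] (Fin n → ℂ)),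
          Leib.IsCentralExtension (a.algebra n) (Leib.F2 n) ε π) ∧
        ¬ Leib.IsSplit (a.algebra n)) ∧
    -- the listed algebras are pairwise non-isomorphic
    (∀ a b : Leib.Entry, Leib.Isomorphic (a.algebra n) (b.algebra n) → a = b) := by
  obtain ⟨k, rfl⟩ := Nat.exists_eq_add_of_le' (show 2 ≤ n by omega)
  have hk : 2 ≤ k := by omega
  refine ⟨?_, fun a => ⟨?_, ?_⟩, fun a b h => ?_⟩
  · intro V H _ _ _ _ brH ε π hV h hs
    obtain ⟨q, hq⟩ := h.exists_model_of_F2 hV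
    obtain ⟨a, ha⟩ := Leib.Quad.exists_entry hk
      (Leib.Quad.spans_of_not_isSplit fun h' => hs (h'.of_isomorphic hq.symm))
    exact ⟨a, hq.trans (ha.trans (a.isomorphic_model k).symm)⟩
  · obtain ⟨φ, hφ⟩ := (a.isomorphic_model k).symm
    obtain ⟨ψ, hψ⟩ := (Leib.F2_isomorphic_base k).symm
    exact ⟨_, _, ((a.quad.isCentralExtension_model k).of_isomorphic φ hφ ψ hψ).comp_equiv
      (LinearEquiv.finTwoArrow ℂ ℂ)⟩
  · exact fun h => a.quad.not_isSplit_model (by omega) a.spans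
      (h.of_isomorphic (a.isomorphic_model k))
  · exact Leib.Entry.eq_of_isomorphic hk
      ((a.isomorphic_model k).symm.trans (h.trans (b.isomorphic_model k)))
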